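/- Let $J[\aleph_2]$ be the collection of all $S\subseteq\omega_2$ for which there exist a club $C\subseteq\omega_2$ and a sequence $\langle f_i:\omega_2\to[\omega_2]^{<2}\mid i<\omega_2\rangle$ such that for every $\alpha\in S\cap C$, every regressive function $f:\alpha\to\alpha$ (i.e. $f(\beta)<\beta$ for all nonzero $\beta<\alpha$), and every cofinal $B\subseteq\alpha$, there exists $i<\alpha$ with $\sup\{\beta\in B\mid f(\beta)\in f_i(\beta)\}=\alpha$; here $[\omega_2]^{<2}$ is the collection of subsets of $\omega_2$ with at most one element. Let $\mathrm{NS}_{\aleph_2}$ be the collection of nonstationary subsets of $\omega_2$, and let $S^2_1=\{\alpha<\omega_2\mid \mathrm{cf}(\alpha)=\aleph_1\}$. Let $m(\aleph_0,\aleph_0,\aleph_0)$ be the least size of a family $\mathcal H$ of functions from $\omega$ to $[\omega]^{<2}$ such that for every infinite $X\subseteq\omega$ and every $g:X\to\omega$ there is $h\in\mathcal H$ for which $\{\xi\in X\mid g(\xi)\in h(\xi)\}$ is infinite. Then the following are equivalent: 1. $J[\aleph_2]=\{S\subseteq\omega_2\mid S\cap S^2_1\text{ is nonstationary}\}$; 2.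 $J[\aleph_2]\neq\mathrm{NS}_{\aleph_2}$; 3. $m(\aleph_0,\aleph_0,\aleph_0)=\aleph_1$; 4. there exists a nonmeager set of reals of size $\aleph_1$. -/

import Mathlib

open Cardinal Ordinal

universe u

/-- The nonstationary ideal over the ordinal `κ`, a collection of subsets of
`κ = {α | α < κ}`. -/
def nonstationaryIdeal (κ : Ordinal.{u}) : Set (Set (Set.Iio κ)) :=
  {S | ¬ IsStationary S}

/-- The set `E^κ_θ` of all `α < κ` of cofinality `θ`. -/
def cofSet (κ : Ordinal.{u}) (θ : Cardinal.{u}) : Set (Set.Iio κ) :=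
  {α | (α : Ordinal.{u}).cof = θ}

/-- The collection `J_χ[κ]` of all `S ⊆ κ` for which there are a club `C ⊆ κ` and functions
`F i : κ → [κ]^{<χ}` (`i < κ`) such that for every `α ∈ S ∩ C`, every regressive `f : α → α`
(that is, `f β < β` for all nonzero `β < α`) and every cofinal `B ⊆ α`, there is `i < α` with
`sup {β ∈ B | f β ∈ F i β} = α`. -/
def idealJLt (χ : Cardinal.{u + 1}) (κ : Ordinal.{u}) : Set (Set (Set.Iio κ)) :=
  {S | ∃ C : Set (Set.Iio κ), IsClub C ∧
    ∃ F : Set.Iio κ → Set.Iio κ → Set (Set.Iio κ), (∀ i β, #(F i β) < χ) ∧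
      ∀ α ∈ S ∩ C, ∀ f : Set.Iio α → Set.Iio α,
        (∀ β : Set.Iio α, ((β : Set.Iio κ) : Ordinal.{u}) ≠ 0 → f β < β) →
        ∀ B : Set (Set.Iio α), IsCofinal B →
          ∃ i < α, IsLUB {β : Set.Iio κ |
            ∃ b : Set.Iio α, b ∈ B ∧ (f b : Set.Iio κ) ∈ F i b ∧ (b : Set.Iio κ) = β} α}

/-- The ideal `J[κ] = J_2[κ]`. -/
def idealJ (κ : Ordinal.{u}) : Set (Set (Set.Iio κ)) :=
  idealJLt 2 κ

/-- `H` is a family of functions from `Δ` to `[Λ]^{<χ}` such that for every `X ∈ [Δ]^θ` and every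
`g : X → Λ` there is `h ∈ H` with `|{ξ ∈ X | g ξ ∈ h ξ}| = θ`. -/
def IsMeetingFamily (Δ Λ : Type u) (θ χ : Cardinal.{u}) (H : Set (Δ → Set Λ)) : Prop :=
  (∀ h ∈ H, ∀ ξ, #(h ξ) < χ) ∧
    ∀ X : Set Δ, #X = θ → ∀ g : X → Λ, ∃ h ∈ H, #{ξ : X | g ξ ∈ h ξ} = θ

/-- The meeting number `m(Δ, λ, θ, χ)`: the least size of a meeting family. The cardinal `λ`, in
its role as a set of size `λ`, is represented by a type `Λ` of that size. -/
noncomputable def meetingNumberLt (Δ Λ : Type u) (θ χ : Cardinal.{u}) : Cardinal.{u} :=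
  sInf {c | ∃ H : Set (Δ → Set Λ), IsMeetingFamily Δ Λ θ χ H ∧ #H = c}

/-- The meeting number `m(Δ, λ, θ) = m(Δ, λ, θ, 2)`. -/
noncomputable def meetingNumber (Δ Λ : Type u) (θ : Cardinal.{u}) : Cardinal.{u} :=
  meetingNumberLt Δ Λ θ 2

/-! On a club, every `α < ω₂` is a limit above `ω₁`, of cofinality `ℵ₀` or `ℵ₁`. At cofinality `ℵ₁`
a diagonal regressive function defeats any `F` (`not_meetsRegressive_of_cof_eq`), so only cofinality
`ℵ₀` matters. There a single good `α` yields a meeting family of size at most `ℵ₁`, by restricting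
the `F i` with `i < α` to an `ω`-sequence cofinal in `α` and to values in `ω`. Conversely, such a
family handles all these `α` at once (`exists_meetsRegressive_of_isMeetingFamily`): eventually
different functions on `ω₁` and countable codings turn the data along an `ω`-sequence into a partial
function on `ω`.

Meeting families and nonmeager sets are exchanged by genericity. A generic real meets a given
partial function infinitely often; conversely, guessing finite words and then their positions builds
a point of a given dense `Gδ`. -/

/-! ### Dense open sets and binary words. -/

theorem exists_cylinder_ofDigits_mem {U : Set ℝ} (hU : IsOpen U) (hd : Dense U)
    (x : ℕ → Fin 2) (n : ℕ) :
    ∃ m ≥ n, ∃ y : ℕ → Fin 2, (∀ i < n, y i = x i) ∧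
      ∀ z : ℕ → Fin 2, (∀ i < m, z i = y i) → Real.ofDigits z ∈ U := by
  set s : ℝ := ∑ i ∈ Finset.range n, Real.ofDigitsTerm x i with hs
  have hpos : (0 : ℝ) < ((2 : ℝ) ^ n)⁻¹ := by positivity
  obtain ⟨v, hv, hvU⟩ := hd.inter_open_nonempty (Set.Ioo s (s + ((2 : ℝ) ^ n)⁻¹)) isOpen_Ioo
    ⟨s + ((2 : ℝ) ^ n)⁻¹ / 2, by constructor <;> linarith⟩
  have ht : (v - s) * 2 ^ n ∈ Set.Icc (0 : ℝ) 1 := by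
    constructor
    · have := hv.1
      have : 0 ≤ v - s := by linarith
      positivity
    · have h1 : v - s ≤ ((2 : ℝ) ^ n)⁻¹ := by linarith [hv.2]
      calc (v - s) * 2 ^ n ≤ ((2 : ℝ) ^ n)⁻¹ * 2 ^ n := by gcongr
        _ = 1 := by field_simp
  obtain ⟨w, -, hw⟩ := Real.ofDigits_SurjOn (b := 2) (by norm_num) ht
  set y : ℕ → Fin 2 := fun i => if i < n then x i else w (i - n) with hy
  have hyx : ∀ i < n, y i = x i := fun i hi => by simp [hy, hi]
  have hyv : Real.ofDigits y = v := by
    rw [Real.ofDigits_eq_sum_add_ofDigits y n]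
    have h1 : ∑ i ∈ Finset.range n, Real.ofDigitsTerm y i = s := by
      refine Finset.sum_congr rfl fun i hi => ?_
      simp [Real.ofDigitsTerm, hyx i (Finset.mem_range.1 hi)]
    have h2 : (fun i => y (i + n)) = w := by
      funext i
      simp [hy]
    rw [h1, h2, hw]
    push_cast
    field_simp
    ring
  obtain ⟨ε, hε, hball⟩ := Metric.isOpen_iff.1 hU v hvU
  obtain ⟨m, hm⟩ := exists_pow_lt_of_lt_one hε (y := (1 / 2 : ℝ)) (by norm_num)
  refine ⟨max m n, le_max_right _ _, y, hyx, fun z hz => hball ?_⟩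
  rw [Metric.mem_ball, Real.dist_eq, ← hyv]
  refine lt_of_le_of_lt (Real.abs_ofDigits_sub_ofDigits_le
    (n := m) fun i hi => hz i (lt_max_of_lt_left hi)) ?_
  simpa using hm

/-- There are finitely many prefixes of length `k`. They are treated one at a time, each extending
the word found so far, which keeps it good for the earlier prefixes. -/
theorem exists_word_forall_ofDigits_mem {U : Set ℝ} (hU : IsOpen U) (hd : Dense U) (k : ℕ) :
    ∃ w : List (Fin 2), ∀ x : ℕ → Fin 2,
      (∀ i < w.length, x (k + i) = w.getD i 0) → Real.ofDigits x ∈ U := by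
  suffices H : ∀ S : Finset (Fin k → Fin 2), ∃ w : List (Fin 2), ∀ x : ℕ → Fin 2,
      (fun i : Fin k => x i) ∈ S →
      (∀ i < w.length, x (k + i) = w.getD i 0) → Real.ofDigits x ∈ U by
    obtain ⟨w, hw⟩ := H Finset.univ
    exact ⟨w, fun x => hw x (Finset.mem_univ _)⟩
  intro S
  induction S using Finset.induction_on with
  | empty => exact ⟨[], by simp⟩
  | insert s S _ ih =>
    obtain ⟨w, hw⟩ := ih
    obtain ⟨m, hm, y, hy, hyU⟩ := exists_cylinder_ofDigits_mem hU hd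
      (fun i => if h : i < k then s ⟨i, h⟩ else w.getD (i - k) 0) (k + w.length)
    refine ⟨List.ofFn fun i : Fin (m - k) => y (k + i), fun x hx hxw => ?_⟩
    have hxy : ∀ i, k ≤ i → i < m → x i = y i := by
      intro i hi him
      have := hxw (i - k) (by simp; omega)
      simpa [Nat.add_sub_cancel' hi, show i - k < m - k by omega] using this
    rcases Finset.mem_insert.1 hx with rfl | hx
    · refine hyU x fun i hi => ?_
      by_cases hik : i < k
      · rw [hy i (by omega), dif_pos hik]
      · exact hxy i (by omega) hi
    · refine hw x hx fun i hi => ?_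
      rw [hxy (k + i) (by omega) (by omega), hy _ (by omega), dif_neg (by omega)]
      simp

/-- For `j` of one parity the intervals `[n j, n (j + 2))` are disjoint, so the prescribed blocks
never conflict. -/
theorem exists_matching_blocks (w : ℕ → List (Fin 2)) (n K : ℕ → ℕ) (hn : Monotone n) (p : ℕ) :
    ∃ x : ℕ → Fin 2, ∀ j, j % 2 = p → n j ≤ K j → K j + (w (K j)).length ≤ n (j + 2) →
      ∀ i < (w (K j)).length, x (K j + i) = (w (K j)).getD i 0 := by
  classical
  let P : ℕ → ℕ → Prop := fun r j => j % 2 = p ∧ n j ≤ r ∧ r < n (j + 2)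
  have huniq : ∀ r j j', P r j → P r j' → j ≤ j' := by
    rintro r j j' ⟨h1, h2, h3⟩ ⟨h1', h2', h3'⟩
    by_contra! hlt
    have := hn (show j' + 2 ≤ j by omega)
    omega
  refine ⟨fun r => if h : ∃ j, P r j then
    (w (K h.choose)).getD (r - K h.choose) 0 else 0, fun j hj h1 h2 i hi => ?_⟩
  have hP : P (K j + i) j := ⟨hj, by omega, by omega⟩
  have hex : ∃ j', P (K j + i) j' := ⟨j, hP⟩
  have heq : hex.choose = j := le_antisymm (huniq (K j + i) _ _ hex.choose_spec hP)
    (huniq (K j + i) _ _ hP hex.choose_spec)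
  calc _ = (w (K hex.choose)).getD (K j + i - K hex.choose) 0 := dif_pos hex
    _ = _ := by rw [heq, Nat.add_sub_cancel_left]

/-! ### Meeting families on `ω`. -/

theorem subsingleton_of_mk_lt_two {A : Type*} {s : Set A} (hs : #s < 2) : s.Subsingleton := by
  rw [← mk_le_one_iff_set_subsingleton]
  refine not_lt.1 fun h1 => hs.not_ge ?_
  exact one_add_one_eq_two (R := Cardinal) ▸ Cardinal.add_one_le_of_lt h1

/-- The element of `s` if `s` is nonempty, and `0` otherwise. -/
noncomputable def pickNat (s : Set ℕ) : ℕ := by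
  classical exact if h : s.Nonempty then h.choose else 0

theorem pickNat_eq {s : Set ℕ} (hs : #s < 2) {v : ℕ} (hv : v ∈ s) : pickNat s = v := by
  have h : s.Nonempty := ⟨v, hv⟩
  rw [pickNat, dif_pos h]
  exact subsingleton_of_mk_lt_two hs h.choose_spec hv

theorem IsMeetingFamily.exists_infinite {H : Set (ℕ → Set ℕ)} (hH : IsMeetingFamily ℕ ℕ ℵ₀ 2 H)
    {X : Set ℕ} (hX : X.Infinite) (g : ℕ → ℕ) :
    ∃ h ∈ H, {n | n ∈ X ∧ g n ∈ h n}.Infinite := by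
  have := hX.to_subtype
  obtain ⟨h, hh, hc⟩ := hH.2 X (Cardinal.mk_eq_aleph0 X) fun n => g n
  refine ⟨h, hh, ?_⟩
  have h1 : Set.Infinite {ξ : X | g ξ ∈ h ξ} := by
    rw [← Set.infinite_coe_iff, Cardinal.infinite_iff]
    exact hc.ge
  refine (h1.image Subtype.val_injective.injOn).mono ?_
  rintro _ ⟨ξ, hξ, rfl⟩
  exact ⟨ξ.2, hξ⟩

theorem isMeetingFamily_of_exists_infinite {H : Set (ℕ → Set ℕ)}
    (h2 : ∀ h ∈ H, ∀ n, (h n).Subsingleton)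
    (hH : ∀ X : Set ℕ, X.Infinite → ∀ g : ℕ → ℕ, ∃ h ∈ H, {n | n ∈ X ∧ g n ∈ h n}.Infinite) :
    IsMeetingFamily ℕ ℕ ℵ₀ 2 H := by
  refine ⟨fun h hh n => ?_, fun X hX g => ?_⟩
  · have := mk_le_one_iff_set_subsingleton.2 (h2 h hh n)
    exact this.trans_lt (by norm_num)
  · have hXi : X.Infinite := by
      rw [← Set.infinite_coe_iff, Cardinal.infinite_iff]
      exact hX.ge
    classical
    obtain ⟨h, hh, hi⟩ := hH X hXi fun n => if hn : n ∈ X then g ⟨n, hn⟩ else 0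
    refine ⟨h, hh, ?_⟩
    have : Set.Infinite {ξ : X | g ξ ∈ h ξ} := by
      refine Set.Infinite.of_image Subtype.val (hi.mono ?_)
      rintro n ⟨hn, hg⟩
      exact ⟨⟨n, hn⟩, by simpa [hn] using hg, rfl⟩
    have := this.to_subtype
    exact Cardinal.mk_eq_aleph0 _

/-- Diagonalization: `g n` avoids the finitely many values allowed at `n` by the first `n + 1`
members. -/
theorem IsMeetingFamily.not_countable {H : Set (ℕ → Set ℕ)} (hH : IsMeetingFamily ℕ ℕ ℵ₀ 2 H) :
    ¬ H.Countable := by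
  intro hc
  obtain ⟨h₀, hh₀, -⟩ := hH.exists_infinite Set.infinite_univ fun _ => 0
  obtain ⟨e, he⟩ := hc.exists_eq_range ⟨h₀, hh₀⟩
  have hfin : ∀ n, (⋃ k ∈ Finset.range (n + 1), e k n).Finite := by
    intro n
    refine Set.Finite.biUnion (Finset.finite_toSet _) fun k _ => ?_
    have : #(e k n) < 2 := hH.1 _ (he ▸ ⟨k, rfl⟩) n
    exact Cardinal.lt_aleph0_iff_set_finite.1 (this.trans (Cardinal.natCast_lt_aleph0 (n := 2)))
  choose g hg using fun n => (hfin n).exists_notMem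
  obtain ⟨h, hh, hi⟩ := hH.exists_infinite Set.infinite_univ g
  obtain ⟨k, rfl⟩ := he ▸ hh
  refine hi ((Set.finite_lt_nat k).subset ?_)
  rintro n ⟨-, hn⟩
  by_contra! hkn
  refine hg n (Set.mem_biUnion (x := k) ?_ hn)
  simp at hkn ⊢
  omega

theorem meetingNumber_eq_aleph_one_iff :
    meetingNumber ℕ ℕ ℵ₀ = ℵ_ 1 ↔ ∃ H, IsMeetingFamily ℕ ℕ ℵ₀ 2 H ∧ #H ≤ ℵ_ 1 := by
  have hge : ∀ H, IsMeetingFamily ℕ ℕ ℵ₀ 2 H → ℵ_ 1 ≤ #H := by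
    intro H hH
    rw [← succ_aleph0, Order.succ_le_iff, ← not_le, Cardinal.le_aleph0_iff_set_countable]
    exact hH.not_countable
  constructor
  · intro h
    have hne : {c | ∃ H, IsMeetingFamily ℕ ℕ ℵ₀ 2 H ∧ #H = c}.Nonempty := by
      by_contra hne
      rw [Set.not_nonempty_iff_eq_empty] at hne
      rw [meetingNumber, meetingNumberLt, hne, Cardinal.sInf_empty] at h
      exact (aleph_pos 1).ne h
    obtain ⟨H, hH, hc⟩ := csInf_mem hne
    exact ⟨H, hH, (hc.trans h).le⟩
  · rintro ⟨H, hH, hc⟩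
    refine le_antisymm (le_trans (b := #H) (csInf_le' ⟨H, hH, rfl⟩) hc)
      (le_csInf ⟨#H, H, hH, rfl⟩ ?_)
    rintro _ ⟨H', hH', rfl⟩
    exact hge H' hH'

/-! ### Meeting families and nonmeager sets of reals. -/

/-- One member guesses, for infinitely many `k`, a word that forces membership in the first `k + 1`
dense open sets when placed at `k`. A second member guesses which such `k` to use in infinitely many
intervals. -/
theorem exists_not_isMeagre_of_isMeetingFamily {H : Set (ℕ → Set ℕ)}
    (hH : IsMeetingFamily ℕ ℕ ℵ₀ 2 H) (hc : #H ≤ ℵ_ 1) : ∃ A : Set ℝ, ¬ IsMeagre A ∧ #A = ℵ_ 1 := by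
  let w : H → ℕ → List (Fin 2) := fun h k => (Encodable.decode (pickNat (h.1 k))).getD []
  -- The growth ensures that a word placed before `n h (j + 1)` ends by `n h (j + 2)`.
  let n : H → ℕ → ℕ := fun h j => Nat.rec 0
    (fun _ N => N + 1 + ∑ k ∈ Finset.range N, (k + (w h k).length)) j
  have hnsucc : ∀ h j, n h (j + 1) =
    n h j + 1 + ∑ k ∈ Finset.range (n h j), (k + (w h k).length) := fun h j => rfl
  have hnmono : ∀ h, StrictMono (n h) := fun h => strictMono_nat_of_lt_succ fun j => by
    have := hnsucc h j
    omega
  have hnle : ∀ h j k, k < n h (j + 1) → k + (w h k).length ≤ n h (j + 2) := by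
    intro h j k hk
    rw [hnsucc h (j + 1)]
    have := Finset.single_le_sum (f := fun k => k + (w h k).length) (fun _ _ => Nat.zero_le _)
      (Finset.mem_range.2 hk)
    omega
  choose x hx using fun t : (H × H) × ℕ => exists_matching_blocks (w t.1.1) (n t.1.1)
    (fun j => pickNat (t.1.2.1 j)) (hnmono t.1.1).monotone t.2
  have hA : ¬ IsMeagre (Set.range fun t => Real.ofDigits (x t)) := by
    intro hM
    rw [IsMeagre, mem_residual_iff] at hM
    obtain ⟨S, hSo, hSd, hSc, hSsub⟩ := hM
    obtain ⟨U, hUo, hUd, hUS⟩ : ∃ U : ℕ → Set ℝ, (∀ k, IsOpen (U k)) ∧ (∀ k, Dense (U k)) ∧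
        ⋂ k, U k ⊆ ⋂₀ S := by
      rcases S.eq_empty_or_nonempty with rfl | hne
      · exact ⟨fun _ => Set.univ, by simp, by simp, by simp⟩
      · obtain ⟨U, rfl⟩ := hSc.exists_eq_range hne
        exact ⟨U, fun k => hSo _ ⟨k, rfl⟩, fun k => hSd _ ⟨k, rfl⟩, by simp⟩
    have hVo : ∀ k, IsOpen (⋂ i ∈ Finset.range (k + 1), U i) := fun k =>
      isOpen_biInter_finset fun i _ => hUo i
    have hVd : ∀ k, Dense (⋂ i ∈ Finset.range (k + 1), U i) := fun k =>
      dense_biInter_of_isOpen (fun i _ => hUo i) (Finset.countable_toSet _) fun i _ => hUd i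
    choose τ hτ using fun k => exists_word_forall_ofDigits_mem (hVo k) (hVd k) k
    obtain ⟨h, hh, hY⟩ := hH.exists_infinite Set.infinite_univ fun k => Encodable.encode (τ k)
    set Y := {k | k ∈ Set.univ ∧ Encodable.encode (τ k) ∈ h k}
    let a : H := ⟨h, hh⟩
    have hYw : ∀ k ∈ Y, w a k = τ k := by
      intro k hk
      change (Encodable.decode (pickNat (h k))).getD [] = τ k
      rw [pickNat_eq (hH.1 h hh k) hk.2]
      simp
    let J : ℕ → Set ℕ := fun p => {j | j % 2 = p ∧ ∃ k ∈ Y, n a j ≤ k ∧ k < n a (j + 1)}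
    obtain ⟨p, hp⟩ : ∃ p, (J p).Infinite := by
      by_contra! hfin
      obtain ⟨N, hN⟩ := ((hfin 0).union (hfin 1)).bddAbove
      obtain ⟨k, hk, hkN⟩ := hY.exists_gt (n a (N + 1))
      obtain ⟨j, hj1, hj2⟩ : ∃ j, n a j ≤ k ∧ k < n a (j + 1) := by
        have hex : ∃ j, k < n a (j + 1) := ⟨k, (hnmono a).le_apply.trans_lt (hnmono a k.lt_succ_self)⟩
        classical
        refine ⟨Nat.find hex, ?_, Nat.find_spec hex⟩
        rcases h0 : Nat.find hex with _ | j
        · exact Nat.zero_le _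
        · exact not_lt.1 (Nat.find_min hex (m := j) (by omega))
      have hjN : j ≤ N := by
        refine hN ?_
        rcases Nat.mod_two_eq_zero_or_one j with h0 | h0
        · exact Or.inl ⟨h0, k, hk, hj1, hj2⟩
        · exact Or.inr ⟨h0, k, hk, hj1, hj2⟩
      have := (hnmono a).monotone (show j + 1 ≤ N + 1 by omega)
      omega
    choose! κ hκ using fun j (hj : j ∈ J p) => hj.2
    -- Meeting on an arbitrary infinite domain is needed here: `κ` is meaningful only on `J p`.
    obtain ⟨h', hh', hZ⟩ := hH.exists_infinite hp κ
    have hmem : Real.ofDigits (x ((a, ⟨h', hh'⟩), p)) ∈ ⋂ k, U k := by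
      refine Set.mem_iInter.2 fun i => ?_
      obtain ⟨j, ⟨hjJ, hjh⟩, hij⟩ := hZ.exists_gt i
      have hpick : pickNat (h' j) = κ j := pickNat_eq (hH.1 h' hh' j) hjh
      obtain ⟨hκY, hκ1, hκ2⟩ := hκ j hjJ
      have := hx ((a, ⟨h', hh'⟩), p) j hjJ.1
      simp only [hpick] at this
      have hm := this hκ1 (hnle a j _ hκ2)
      rw [hYw _ hκY] at hm
      have hV := hτ _ _ hm
      simp only [Set.mem_iInter, Finset.mem_range] at hV
      refine hV i ?_
      have := (hnmono a).le_apply (x := j)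
      omega
    exact hSsub (hUS hmem) ⟨_, rfl⟩
  refine ⟨_, hA, le_antisymm ?_ ?_⟩
  · refine mk_range_le.trans ?_
    simp only [mk_prod, Cardinal.lift_id, mk_nat]
    calc #H * #H * ℵ₀ ≤ ℵ_ 1 * ℵ_ 1 * ℵ_ 1 := by gcongr; exact aleph0_le_aleph 1
      _ = ℵ_ 1 := by simp
  · rw [← succ_aleph0, Order.succ_le_iff, ← not_le, Cardinal.le_aleph0_iff_set_countable]
    intro hcount
    refine hA ?_
    rw [← Set.biUnion_of_singleton (Set.range fun t => Real.ofDigits (x t))]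
    have := hcount.to_subtype
    rw [Set.biUnion_eq_iUnion]
    refine isMeagre_iUnion fun y => IsNowhereDense.isMeagre ?_
    simp [IsNowhereDense]

theorem exists_isMeetingFamily_of_not_isMeagre {A : Set ℝ} (hA : ¬ IsMeagre A) (hc : #A = ℵ_ 1) :
    ∃ H, IsMeetingFamily ℕ ℕ ℵ₀ 2 H ∧ #H ≤ ℵ_ 1 := by
  -- When the fractional part is nonzero, the value is `v` exactly if that part lies in `(1/(v+2),
  -- 1/(v+1)]`.
  let h : ℝ → ℕ → Set ℕ := fun x n => {⌊(Int.fract (2 ^ n * x))⁻¹⌋₊ - 1}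
  refine ⟨h '' A, isMeetingFamily_of_exists_infinite ?_ fun X hX g => ?_, mk_image_le.trans hc.le⟩
  · rintro _ ⟨x, -, rfl⟩ n
    exact Set.subsingleton_singleton
  let O : ℕ → Set ℝ := fun n => ⋃ m : ℤ,
    {x | m + (1 : ℝ) / (g n + 2) < 2 ^ n * x ∧ 2 ^ n * x < m + (1 : ℝ) / (g n + 1)}
  have hOo : ∀ n, IsOpen (O n) := fun n => isOpen_iUnion fun m =>
    (isOpen_lt continuous_const (continuous_const_mul _)).and
      (isOpen_lt (continuous_const_mul _) continuous_const)
  have hOh : ∀ n, ∀ x ∈ O n, g n ∈ h x n := by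
    intro n x hx
    obtain ⟨m, h1, h2⟩ := Set.mem_iUnion.1 hx
    have hg : (0 : ℝ) ≤ g n := Nat.cast_nonneg _
    have hlt1 : (1 : ℝ) / (g n + 1) ≤ 1 := by
      rw [div_le_one (by positivity)]; linarith
    have hpos : (0 : ℝ) < 1 / (g n + 2) := by positivity
    have hfl : ⌊(2 : ℝ) ^ n * x⌋ = m := by
      rw [Int.floor_eq_iff]
      constructor <;> linarith
    have hfr : Int.fract ((2 : ℝ) ^ n * x) = 2 ^ n * x - m := by
      rw [Int.fract, hfl]
    set t := (2 : ℝ) ^ n * x - m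
    have ht1 : 1 / ((g n : ℝ) + 2) < t := by simp only [t]; linarith
    have ht2 : t < 1 / ((g n : ℝ) + 1) := by simp only [t]; linarith
    have ht0 : 0 < t := hpos.trans ht1
    have hfloor : ⌊t⁻¹⌋₊ = g n + 1 := by
      rw [Nat.floor_eq_iff (by positivity)]
      push_cast
      constructor
      · rw [le_inv_comm₀ (by positivity) ht0, ← one_div]; exact ht2.le
      · rw [inv_lt_comm₀ ht0 (by positivity), ← one_div]; rwa [_root_.add_assoc, one_add_one_eq_two]
    simp only [h, Set.mem_singleton_iff]
    rw [hfr, hfloor]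
    simp
  -- `O n` has period `2⁻ⁿ`, so it comes within `2⁻ⁿ` of every real; `X` has arbitrarily large `n`.
  have hdense : ∀ N, Dense (⋃ n ∈ {n | n ∈ X ∧ N < n}, O n) := by
    intro N
    refine dense_iff_inter_open.2 fun V hV ⟨v, hv⟩ => ?_
    obtain ⟨ε, hε, hball⟩ := Metric.isOpen_iff.1 hV v hv
    obtain ⟨k, hk⟩ := exists_pow_lt_of_lt_one hε (y := (1 / 2 : ℝ)) (by norm_num)
    obtain ⟨n, hnX, hn⟩ := hX.exists_gt (max N k)
    have hg : (0 : ℝ) ≤ g n := Nat.cast_nonneg _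
    have hlt : (1 : ℝ) / (g n + 2) < 1 / (g n + 1) := by
      apply one_div_lt_one_div_of_lt <;> linarith
    have hlt1 : (1 : ℝ) / (g n + 1) ≤ 1 := by
      rw [div_le_one (by positivity)]; linarith
    have hpos : (0 : ℝ) < 1 / (g n + 2) := by positivity
    obtain ⟨c, hc1, hc2⟩ := exists_between hlt
    have h2 : (0 : ℝ) < 2 ^ n := by positivity
    have key : (2 : ℝ) ^ n * ((⌊(2 : ℝ) ^ n * v⌋ + c) / 2 ^ n) = ⌊(2 : ℝ) ^ n * v⌋ + c := by
      field_simp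
    refine ⟨(⌊(2 : ℝ) ^ n * v⌋ + c) / 2 ^ n, hball ?_, ?_⟩
    · rw [Metric.mem_ball, Real.dist_eq]
      have hb : |(2 : ℝ) ^ n * ((⌊(2 : ℝ) ^ n * v⌋ + c) / 2 ^ n - v)| ≤ 1 := by
        rw [_root_.mul_sub, key, abs_le]
        have := Int.floor_le ((2 : ℝ) ^ n * v)
        have := Int.lt_floor_add_one ((2 : ℝ) ^ n * v)
        constructor <;> linarith
      rw [abs_mul, abs_of_pos h2] at hb
      have h3 : |(⌊(2 : ℝ) ^ n * v⌋ + c) / 2 ^ n - v| ≤ (1 / 2) ^ n := by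
        rw [one_div, inv_pow, ← one_div, le_div_iff₀' h2]
        exact hb
      refine h3.trans_lt (lt_of_le_of_lt ?_ hk)
      exact pow_le_pow_of_le_one (by norm_num) (by norm_num)
        ((le_max_right N k).trans hn.le)
    · refine Set.mem_biUnion (x := n) ⟨hnX, (le_max_left N k).trans_lt hn⟩ ?_
      refine Set.mem_iUnion.2 ⟨⌊(2 : ℝ) ^ n * v⌋, ?_⟩
      simp only [Set.mem_ofPred_eq, key]
      constructor <;> linarith
  have hres : (⋂ N, ⋃ n ∈ {n | n ∈ X ∧ N < n}, O n) ∈ residual ℝ :=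
    countable_iInter_mem.2 fun N =>
      residual_of_dense_open (isOpen_biUnion fun n _ => hOo n) (hdense N)
  obtain ⟨x, hxA, hx⟩ : (A ∩ ⋂ N, ⋃ n ∈ {n | n ∈ X ∧ N < n}, O n).Nonempty := by
    by_contra hne
    rw [Set.not_nonempty_iff_eq_empty, ← Set.disjoint_iff_inter_eq_empty] at hne
    exact hA (Filter.mem_of_superset hres hne.subset_compl_left)
  refine ⟨h x, ⟨x, hxA, rfl⟩, Set.infinite_of_not_bddAbove ?_⟩
  rintro ⟨N, hN⟩
  obtain ⟨n, ⟨hnX, hnN⟩, hn⟩ := Set.mem_iUnion₂.1 (Set.mem_iInter.1 hx N)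
  exact absurd (hN ⟨hnX, hOh n x hn⟩) (not_le.2 hnN)

/-! ### Countable cofinality in linear orders. -/

theorem exists_forall_lt_of_countable {P : Type*} [LinearOrder P] (hP : ℵ₀ < Order.cof P)
    {s : Set P} (hs : s.Countable) : ∃ a, ∀ b ∈ s, b < a := by
  refine not_isCofinal_iff.1 fun h => ?_
  exact (Order.cof_le h).not_gt ((Cardinal.le_aleph0_iff_set_countable.2 hs).trans_lt hP)

theorem exists_strictMono_nat_isCofinal_range {P : Type*} [LinearOrder P] [NoMaxOrder P]
    (hP : Order.cof P = ℵ₀) {B : Set P} (hB : IsCofinal B) :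
    ∃ b : ℕ → P, StrictMono b ∧ (∀ n, b n ∈ B) ∧ ∀ x, ∃ n, x < b n := by
  obtain ⟨s, hs, hc⟩ := Order.exists_cof_eq P
  rw [hP] at hc
  have hsne : s.Nonempty := by
    by_contra hne
    rw [Set.not_nonempty_iff_eq_empty] at hne
    subst hne
    exact aleph0_ne_zero (by simpa using hc.symm)
  obtain ⟨c, rfl⟩ := (Cardinal.le_aleph0_iff_set_countable.1 hc.le).exists_eq_range hsne
  have hgt : ∀ x, ∃ y ∈ B, x < y := fun x => by
    obtain ⟨z, hz⟩ := exists_gt x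
    obtain ⟨y, hy, hzy⟩ := hB z
    exact ⟨y, hy, hz.trans_le hzy⟩
  choose nxt hnxt hlt using hgt
  let b : ℕ → P := fun n => Nat.rec (nxt (c 0)) (fun n y => nxt (max y (c (n + 1)))) n
  have hbc : ∀ n, c n < b n := by
    rintro (_ | n)
    · exact hlt _
    · exact (le_max_right _ _).trans_lt (hlt (max (b n) (c (n + 1))))
  refine ⟨b, strictMono_nat_of_lt_succ fun n =>
    (le_max_left _ _).trans_lt (hlt (max (b n) (c (n + 1)))), ?_, fun x => ?_⟩
  · rintro (_ | n)
    · exact hnxt _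
    · exact hnxt _
  · obtain ⟨_, ⟨n, rfl⟩, hn⟩ := hs x
    exact ⟨n, hn.trans_lt (hbc n)⟩

theorem exists_strictMono_nat_mem {P : Type*} [LinearOrder P] [NoMaxOrder P] {t : Set P}
    (ht : IsCofinal t) (x : P) : ∃ b : ℕ → P, StrictMono b ∧ (∀ n, b n ∈ t) ∧ x < b 0 := by
  have hgt : ∀ x, ∃ y ∈ t, x < y := fun x => by
    obtain ⟨z, hz⟩ := exists_gt x
    obtain ⟨y, hy, hzy⟩ := ht z
    exact ⟨y, hy, hz.trans_le hzy⟩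
  choose nxt hnxt hlt using hgt
  let b : ℕ → P := fun n => Nat.rec (nxt x) (fun _ y => nxt y) n
  refine ⟨b, strictMono_nat_of_lt_succ fun n => hlt (b n), ?_, hlt x⟩
  rintro (_ | n)
  · exact hnxt _
  · exact hnxt _

theorem exists_isLUB_range_nat {P : Type*} [LinearOrder P] [WellFoundedLT P]
    (hP : ℵ₀ < Order.cof P) (b : ℕ → P) : ∃ a, IsLUB (Set.range b) a := by
  obtain ⟨c, hc⟩ := exists_forall_lt_of_countable hP (Set.countable_range b)
  have hne : (upperBounds (Set.range b)).Nonempty := ⟨c, fun y hy => (hc y hy).le⟩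
  exact ⟨_, wellFounded_lt.min_mem _ hne, fun y hy => wellFounded_lt.min_le hy⟩

theorem cof_Iio_eq_aleph0_of_isLUB {P : Type u} [LinearOrder P] {b : ℕ → P} (hb : StrictMono b)
    {a : P} (ha : IsLUB (Set.range b) a) : Order.cof (Set.Iio a) = ℵ₀ := by
  have hlt : ∀ n, b n < a := fun n => (hb n.lt_succ_self).trans_le (ha.1 ⟨n + 1, rfl⟩)
  let c : ℕ → Set.Iio a := fun n => ⟨b n, hlt n⟩
  have hc : StrictMono c := fun m n h => hb h
  have := Order.lift_cof_congr_of_strictMono hc (by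
    rintro ⟨x, hx⟩
    obtain ⟨_, ⟨n, rfl⟩, hn⟩ := (lt_isLUB_iff ha).1 hx
    exact ⟨c n, ⟨n, rfl⟩, hn.le⟩)
  simpa using this.symm

/-! ### The ordinals `ω₁` and `ω₂`. -/

/-- A well-ordered type of order type `ω₁`. -/
abbrev OmegaOne : Type := (ℵ_ 1 : Cardinal.{0}).ord.ToType

theorem mk_omegaOne : #OmegaOne = ℵ_ 1 := by simp [OmegaOne]

theorem aleph0_lt_cof_omegaOne : ℵ₀ < Order.cof OmegaOne := by
  rw [Ordinal.cof_toType, isRegular_aleph_one.cof_ord]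
  exact aleph0_lt_aleph_one

theorem countable_Iio_omegaOne (γ : OmegaOne) : (Set.Iio γ).Countable := by
  rw [← Cardinal.le_aleph0_iff_set_countable, ← Order.lt_succ_iff, succ_aleph0]
  simpa using mk_Iio_lt γ (by simp)

theorem exists_injOn_nat_of_countable {A : Type*} {s : Set A} (hs : s.Countable) :
    ∃ ε : A → ℕ, Set.InjOn ε s :=
  Set.countable_iff_exists_injOn.1 hs

/-- The ordinal `ω₂`, as a linear order. -/
abbrev OmegaTwo : Type 1 := Set.Iio (ω_ 2 : Ordinal.{0})

instance : NoMaxOrder OmegaTwo where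
  exists_gt x := ⟨⟨Order.succ x.1, (isSuccLimit_omega 2).succ_lt x.2⟩, Order.lt_succ x.1⟩

/-- The ordinal `ω₁`, as an element of `ω₂`. -/
noncomputable def omegaOneMem : OmegaTwo := ⟨ω_ 1, omega_lt_omega.2 (by norm_num)⟩

/-- The ordinal `0`, as an element of `ω₂`. -/
noncomputable def zeroMem : OmegaTwo := ⟨0, omega_pos 2⟩

theorem zeroMem_lt_iff {β : OmegaTwo} : zeroMem < β ↔ (β : Ordinal.{0}) ≠ 0 :=
  pos_iff_ne_zero (a := (β : Ordinal.{0}))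

theorem zeroMem_lt_omegaOneMem : zeroMem < omegaOneMem := omega_pos 1

/-- Initial segments of `ω₂` are initial segments of the ordinals. -/
def iioOmegaTwoOrderIso (α : OmegaTwo) : Set.Iio α ≃o Set.Iio (α : Ordinal.{0}) where
  toFun x := ⟨x.1.1, Set.mem_Iio.2 (Set.mem_Iio.1 x.2)⟩
  invFun x := ⟨⟨x.1, Set.mem_Iio.2 ((Set.mem_Iio.1 x.2).trans (Set.mem_Iio.1 α.2))⟩,
    Set.mem_Iio.2 (Set.mem_Iio.1 x.2)⟩
  left_inv _ := rfl
  right_inv _ := rfl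
  map_rel_iff' := Iff.rfl

theorem mk_Iio_omegaTwo (α : OmegaTwo) : #(Set.Iio α) = lift.{1} α.1.card := by
  rw [← Cardinal.mk_Iio_ordinal]
  exact Cardinal.mk_congr (iioOmegaTwoOrderIso α).toEquiv

theorem mk_Iio_omegaTwo_le (α : OmegaTwo) : #(Set.Iio α) ≤ ℵ_ 1 := by
  rw [mk_Iio_omegaTwo]
  have h : α.1.card < ℵ_ 2 := by
    rw [← lt_ord, ord_aleph]
    exact α.2
  have h2 : (ℵ_ 2 : Cardinal.{0}) = Order.succ (ℵ_ 1) := by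
    rw [succ_aleph, one_add_one_eq_two]
  rw [h2, Order.lt_succ_iff] at h
  simpa using Cardinal.lift_le.{1}.2 h

theorem not_countable_Iio_omegaTwo {β : OmegaTwo} (h : omegaOneMem ≤ β) :
    ¬ (Set.Iio β).Countable := by
  rw [← Cardinal.le_aleph0_iff_set_countable, mk_Iio_omegaTwo, not_le, aleph0_lt_lift]
  refine aleph0_lt_aleph_one.trans_le ?_
  rw [← ord_le, ord_aleph]
  exact h

theorem cof_Iio_omegaTwo (α : OmegaTwo) : Order.cof (Set.Iio α) = lift.{1} α.1.cof := by
  rw [lift_cof, ← Ordinal.cof_Iio]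
  exact OrderIso.cof_congr (iioOmegaTwoOrderIso α)

theorem aleph0_lt_cof_omegaTwo : ℵ₀ < Order.cof OmegaTwo := by
  have h : (ℵ_ 2 : Cardinal.{0}).IsRegular := by
    have := isRegular_aleph_add_one 1
    rwa [one_add_one_eq_two] at this
  rw [Ordinal.cof_Iio, ← lift_cof, ← ord_aleph, h.cof_ord, aleph0_lt_lift]
  exact aleph0_lt_aleph_one.trans (aleph_lt_aleph.2 (by norm_num))

theorem mem_cofSet_aleph_one_iff {α : OmegaTwo} :
    α ∈ cofSet (ω_ 2) (ℵ_ 1) ↔ Order.cof (Set.Iio α) = ℵ_ 1 := by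
  rw [cof_Iio_omegaTwo, cofSet, Set.mem_ofPred_eq, ← Cardinal.lift_inj.{0, 1}, lift_aleph,
    Ordinal.lift_one]

/-- The limit ordinals of `ω₂` above `ω₁`. -/
def limitSet : Set OmegaTwo :=
  {α | omegaOneMem < α ∧ ∀ x < α, ∃ y, x < y ∧ y < α}

theorem mem_limitSet_of_isLUB {b : ℕ → OmegaTwo} (hb : StrictMono b) (h0 : omegaOneMem < b 0)
    {a : OmegaTwo} (ha : IsLUB (Set.range b) a) : a ∈ limitSet := by
  refine ⟨h0.trans_le (ha.1 ⟨0, rfl⟩), fun x hx => ?_⟩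
  obtain ⟨_, ⟨n, rfl⟩, hn⟩ := (lt_isLUB_iff ha).1 hx
  exact ⟨b n, hn, (hb n.lt_succ_self).trans_le (ha.1 ⟨n + 1, rfl⟩)⟩

theorem isClub_limitSet : IsClub limitSet := by
  refine ⟨fun s hs hs₀ _ a ha => ⟨?_, fun x hx => ?_⟩, fun x => ?_⟩
  · obtain ⟨y, hy⟩ := hs₀
    exact (hs hy).1.trans_le (ha.1 hy)
  · obtain ⟨y, hy, hxy⟩ := (lt_isLUB_iff ha).1 hx
    obtain ⟨z, hz, hzy⟩ := (hs hy).2 x hxy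
    exact ⟨z, hz, hzy.trans_le (ha.1 hy)⟩
  · obtain ⟨b, hb, -, h0⟩ := exists_strictMono_nat_mem (P := OmegaTwo) .univ (max x omegaOneMem)
    obtain ⟨a, ha⟩ := exists_isLUB_range_nat aleph0_lt_cof_omegaTwo b
    exact ⟨a, mem_limitSet_of_isLUB hb ((le_max_right _ _).trans_lt h0) ha,
      ((le_max_left _ _).trans h0.le).trans (ha.1 ⟨0, rfl⟩)⟩

theorem noMaxOrder_Iio {α : OmegaTwo} (hα : α ∈ limitSet) : NoMaxOrder (Set.Iio α) where
  exists_gt x := let ⟨y, h1, h2⟩ := hα.2 x x.2; ⟨⟨y, h2⟩, h1⟩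

theorem cof_Iio_of_mem_limitSet {α : OmegaTwo} (hα : α ∈ limitSet) :
    Order.cof (Set.Iio α) = ℵ₀ ∨ Order.cof (Set.Iio α) = ℵ_ 1 := by
  have := noMaxOrder_Iio hα
  have : Nonempty (Set.Iio α) := ⟨⟨_, hα.1⟩⟩
  have h1 : ℵ₀ ≤ Order.cof (Set.Iio α) := Order.aleph0_le_cof
  have h2 : Order.cof (Set.Iio α) ≤ ℵ_ 1 := (Order.cof_le_cardinalMk _).trans (mk_Iio_omegaTwo_le α)
  rcases h1.eq_or_lt with h | h
  · exact Or.inl h.symm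
  · rw [← Order.succ_le_iff, succ_aleph0] at h
    exact Or.inr (h2.antisymm h)

theorem isStationary_cofSet_aleph0 : IsStationary (cofSet (ω_ 2 : Ordinal.{0}) ℵ₀) := by
  intro t ht
  obtain ⟨b, hb, hbt, -⟩ := exists_strictMono_nat_mem ht.isCofinal omegaOneMem
  obtain ⟨a, ha⟩ := exists_isLUB_range_nat aleph0_lt_cof_omegaTwo b
  refine ⟨a, ?_, ht.isLUB_mem (Set.range_subset_iff.2 hbt) (Set.range_nonempty b) ha⟩
  have := cof_Iio_eq_aleph0_of_isLUB hb ha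
  rw [cof_Iio_omegaTwo, ← lift_aleph0.{1, 0}, Cardinal.lift_inj] at this
  exact this

/-! ### Meeting regressive functions at a single ordinal. -/

/-- The functions `F i` with `i < α` meet all regressive functions on `α` along all cofinal subsets
of `α`. -/
def MeetsRegressive (F : OmegaTwo → OmegaTwo → Set OmegaTwo) (α : OmegaTwo) : Prop :=
  ∀ f : Set.Iio α → Set.Iio α,
    (∀ β : Set.Iio α, ((β : OmegaTwo) : Ordinal.{0}) ≠ 0 → f β < β) →
    ∀ B : Set (Set.Iio α), IsCofinal B →
      ∃ i < α, IsLUB {β : OmegaTwo |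
        ∃ b : Set.Iio α, b ∈ B ∧ (f b : OmegaTwo) ∈ F i b ∧ (b : OmegaTwo) = β} α

theorem mem_idealJ_iff {S : Set OmegaTwo} : S ∈ idealJ (ω_ 2 : Ordinal.{0}) ↔
    ∃ C, IsClub C ∧ ∃ F : OmegaTwo → OmegaTwo → Set OmegaTwo, (∀ i β, #(F i β) < 2) ∧
      ∀ α ∈ S ∩ C, MeetsRegressive F α :=
  Iff.rfl

theorem isCofinal_Iio_inter_Ici {α : OmegaTwo} (hα : omegaOneMem < α) {B : Set (Set.Iio α)}
    (hB : IsCofinal B) : IsCofinal (B ∩ {β | omegaOneMem ≤ β}) := by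
  intro x
  obtain ⟨y, hy, hxy⟩ := hB (max x ⟨omegaOneMem, hα⟩)
  exact ⟨y, ⟨hy, (le_max_right _ _).trans hxy⟩, (le_max_left _ _).trans hxy⟩

/-- Enumerate `α` as `s` in type `ω₁`. Only countably many `η` have `s η' ≤ β` for all `η' ≤ η`, so
some value below the uncountable `β` escapes every such `F (s η) β`. Each index is then met only
boundedly often. -/
theorem not_meetsRegressive_of_cof_eq {F : OmegaTwo → OmegaTwo → Set OmegaTwo}
    (hF : ∀ i β, #(F i β) < 2) {α : OmegaTwo} (hα : α ∈ limitSet)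
    (hcof : Order.cof (Set.Iio α) = ℵ_ 1) : ¬ MeetsRegressive F α := by
  intro h
  have := noMaxOrder_Iio hα
  have : Nonempty (Set.Iio α) := ⟨⟨_, hα.1⟩⟩
  obtain ⟨j⟩ : Nonempty (Set.Iio α ↪ OmegaOne) := by
    rw [← Cardinal.lift_mk_le']
    simpa [-mk_toType, mk_omegaOne] using mk_Iio_omegaTwo_le α
  let s : OmegaOne → Set.Iio α := Function.invFun j
  have hs : Function.Surjective s := Function.invFun_surjective j.injective
  have hcount : ∀ β : Set.Iio α, {η | ∀ η' ≤ η, s η' ≤ β}.Countable := by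
    intro β
    obtain ⟨β', hβ'⟩ := exists_gt β
    obtain ⟨η₀, rfl⟩ := hs β'
    refine (countable_Iio_omegaOne η₀).mono fun η hη => ?_
    by_contra! hle
    exact (hη η₀ (not_lt.1 hle)).not_gt hβ'
  have hex : ∀ β : Set.Iio α, ∃ v : Set.Iio α,
      (((β : OmegaTwo) : Ordinal.{0}) ≠ 0 → v < β) ∧ (omegaOneMem ≤ β →
        ∀ η, (∀ η' ≤ η, s η' ≤ β) → (v : OmegaTwo) ∉ F (s η) β) := by
    intro β
    by_cases hβ : omegaOneMem ≤ β
    · have hc : (⋃ η ∈ {η | ∀ η' ≤ η, s η' ≤ β}, F (s η) β).Countable :=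
        (hcount β).biUnion fun η _ => (subsingleton_of_mk_lt_two (hF _ _)).countable
      obtain ⟨v, hv, hvn⟩ : ∃ v ∈ Set.Iio (β : OmegaTwo),
          v ∉ ⋃ η ∈ {η | ∀ η' ≤ η, s η' ≤ β}, F (s η) β := by
        by_contra! hsub
        exact not_countable_Iio_omegaTwo hβ (hc.mono hsub)
      refine ⟨⟨v, Set.mem_Iio.2 (lt_trans hv (Set.mem_Iio.1 β.2))⟩, fun _ => hv, fun _ η hη hmem => hvn ?_⟩
      exact Set.mem_biUnion (x := η) hη hmem
    · exact ⟨⟨zeroMem, zeroMem_lt_omegaOneMem.trans hα.1⟩,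
        fun hβ => zeroMem_lt_iff.2 hβ, fun h => absurd h hβ⟩
  choose f hf1 hf2 using hex
  obtain ⟨i, hi, hlub⟩ := h f hf1 _ (isCofinal_Iio_inter_Ici hα.1 .univ)
  obtain ⟨η, hη⟩ := hs ⟨i, hi⟩
  -- Uncountable cofinality bounds all `s η'` with `η' ≤ η`; above that bound `f` avoids `F (s η)`.
  obtain ⟨β₀, hβ₀⟩ := exists_forall_lt_of_countable (P := Set.Iio α)
    (hcof ▸ aleph0_lt_aleph_one) (((countable_Iio_omegaOne η).insert η).image s)
  obtain ⟨_, ⟨β, ⟨-, hβ⟩, hβF, rfl⟩, hlt⟩ := (lt_isLUB_iff hlub).1 β₀.2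
  refine hf2 β hβ η (fun η' hη' => ?_) (by rwa [hη])
  refine (hβ₀ _ ⟨η', ?_, rfl⟩).le.trans (le_of_lt hlt)
  exact hη'.eq_or_lt

theorem exists_isMeetingFamily_of_meetsRegressive {F : OmegaTwo → OmegaTwo → Set OmegaTwo}
    (hF : ∀ i β, #(F i β) < 2) {α : OmegaTwo} (hα : α ∈ limitSet)
    (hcof : Order.cof (Set.Iio α) = ℵ₀) (h : MeetsRegressive F α) :
    ∃ H, IsMeetingFamily ℕ ℕ ℵ₀ 2 H ∧ #H ≤ ℵ_ 1 := by
  classical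
  have := noMaxOrder_Iio hα
  obtain ⟨b, hb, hbB, hbx⟩ := exists_strictMono_nat_isCofinal_range hcof
    (isCofinal_Iio_inter_Ici hα.1 .univ)
  -- Natural numbers lie below all points of `b`, so any `g` copied along `b` is regressive.
  let ι : ℕ → OmegaTwo := fun n => ⟨n, (natCast_lt_omega0 n).trans_le (omega0_le_omega 2)⟩
  have hι : Function.Injective ι := fun m n hmn => by
    simpa [ι] using congrArg (fun x : OmegaTwo => (x : Ordinal.{0})) hmn
  have hι1 : ∀ n, ι n < omegaOneMem := fun n => (natCast_lt_omega0 n).trans_le (omega0_le_omega 1)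
  let H : Set (ℕ → Set ℕ) := Set.range fun (i : Set.Iio α) n => {v | ι v ∈ F i (b n)}
  refine ⟨H, isMeetingFamily_of_exists_infinite ?_ fun X hX g => ?_, ?_⟩
  · rintro _ ⟨i, rfl⟩ n v hv v' hv'
    exact hι (subsingleton_of_mk_lt_two (hF _ _) hv hv')
  · let f : Set.Iio α → Set.Iio α := fun β =>
      if hβ : ∃ n, b n = β then ⟨ι (g hβ.choose), (hι1 _).trans hα.1⟩
      else ⟨zeroMem, zeroMem_lt_omegaOneMem.trans hα.1⟩
    have hfb : ∀ n, (f (b n) : OmegaTwo) = ι (g n) := by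
      intro n
      have hn : ∃ m, b m = b n := ⟨n, rfl⟩
      simp only [f, dif_pos hn, hb.injective hn.choose_spec]
    have hfreg : ∀ β : Set.Iio α, ((β : OmegaTwo) : Ordinal.{0}) ≠ 0 → f β < β := by
      intro β hβ
      by_cases hn : ∃ n, b n = β
      · obtain ⟨n, rfl⟩ := hn
        rw [← Subtype.coe_lt_coe, hfb]
        exact (hι1 _).trans_le (hbB n).2
      · simp only [f, dif_neg hn]
        exact zeroMem_lt_iff.2 hβ
    obtain ⟨i, hi, hlub⟩ := h f hfreg (b '' X) (fun x => by
      obtain ⟨n, hn⟩ := hbx x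
      obtain ⟨m, hm, hnm⟩ := hX.exists_gt n
      exact ⟨b m, ⟨m, hm, rfl⟩, hn.le.trans (hb hnm).le⟩)
    refine ⟨_, ⟨⟨i, hi⟩, rfl⟩, Set.infinite_of_not_bddAbove ?_⟩
    rintro ⟨N, hN⟩
    obtain ⟨_, ⟨_, ⟨n, hnX, rfl⟩, hmem, rfl⟩, hlt⟩ := (lt_isLUB_iff hlub).1 (b N).2
    rw [hfb] at hmem
    exact (hb.lt_iff_lt.1 hlt).not_ge (hN ⟨hnX, hmem⟩)
  · have : lift.{1} #H ≤ lift.{0} #(Set.Iio α) := mk_range_le_lift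
    rw [← Cardinal.lift_le.{1}]
    refine this.trans ?_
    simpa using mk_Iio_omegaTwo_le α

/-- Recursion on `β`: at `δ` only countably many `ξ < β` have `e β ξ < δ`, and their values are
bounded in `ω₁`. Hence a single `δ` can separate all points of an `ω`-sequence. -/
theorem exists_eventually_different {P : Type*} [LinearOrder P] [WellFoundedLT P]
    {e : P → P → OmegaOne} (he : ∀ β, Set.InjOn (e β) (Set.Iio β)) :
    ∃ g : P → OmegaOne → OmegaOne, ∀ ξ β, ξ < β → ∀ δ, e β ξ < δ → g β δ ≠ g ξ δ := by
  have step : ∀ (β : P) (prev : ∀ ξ, ξ < β → OmegaOne → OmegaOne), ∃ y : OmegaOne → OmegaOne,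
      ∀ δ ξ (h : ξ < β), e β ξ < δ → y δ ≠ prev ξ h δ := by
    intro β prev
    have : ∀ δ, ∃ y, ∀ ξ (h : ξ < β), e β ξ < δ → y ≠ prev ξ h δ := by
      intro δ
      have hc : {ξ : Set.Iio β | e β ξ < δ}.Countable :=
        Set.MapsTo.countable_of_injOn (f := fun ξ : Set.Iio β => e β ξ) (fun _ h => h)
          (fun x _ y _ hxy => Subtype.ext (he β x.2 y.2 hxy)) (countable_Iio_omegaOne δ)
      obtain ⟨y, hy⟩ := exists_forall_lt_of_countable aleph0_lt_cof_omegaOne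
        (hc.image fun ξ => prev ξ.1 ξ.2 δ)
      exact ⟨y, fun ξ h hδ => (hy _ ⟨⟨ξ, h⟩, hδ, rfl⟩).ne'⟩
    choose y hy using this
    exact ⟨y, hy⟩
  choose stp hstp using step
  refine ⟨(wellFounded_lt (α := P)).fix stp, fun ξ β hξ δ hδ => ?_⟩
  rw [WellFounded.fix_eq]
  exact hstp β _ δ ξ hξ hδ

theorem exists_meetsRegressive_of_isMeetingFamily {H : Set (ℕ → Set ℕ)}
    (hH : IsMeetingFamily ℕ ℕ ℵ₀ 2 H) (hc : #H ≤ ℵ_ 1) :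
    ∃ F : OmegaTwo → OmegaTwo → Set OmegaTwo, (∀ i β, #(F i β) < 2) ∧
      ∀ α ∈ limitSet, Order.cof (Set.Iio α) = ℵ₀ → MeetsRegressive F α := by
  classical
  obtain ⟨h₀, hh₀, -⟩ := hH.exists_infinite Set.infinite_univ fun _ => 0
  have : Nonempty H := ⟨⟨h₀, hh₀⟩⟩
  have hne : Nonempty OmegaOne := by
    rw [← Cardinal.mk_ne_zero_iff, mk_omegaOne]
    exact (aleph_pos 1).ne'
  choose ε hε using fun γ : OmegaOne => exists_injOn_nat_of_countable (countable_Iio_omegaOne γ)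
  have he : ∀ β : OmegaTwo, ∃ e : OmegaTwo → OmegaOne, Set.InjOn e (Set.Iio β) := by
    intro β
    obtain ⟨j⟩ : Nonempty (Set.Iio β ↪ OmegaOne) := by
      rw [← Cardinal.lift_mk_le']
      simpa [-mk_toType, mk_omegaOne] using mk_Iio_omegaTwo_le β
    refine ⟨fun ξ => if h : ξ < β then j ⟨ξ, h⟩ else hne.some, fun x hx y hy hxy => ?_⟩
    simp only [Set.mem_Iio] at hx hy
    simp only [hx, hy, dif_pos] at hxy
    exact congrArg Subtype.val (j.injective hxy)
  choose e he using he
  obtain ⟨g, hg⟩ := exists_eventually_different he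
  -- All parameter triples appear below `ω₁`, hence below every `α ∈ limitSet`.
  obtain ⟨τ, hτ⟩ : ∃ τ : OmegaTwo → H × OmegaOne × OmegaOne,
      ∀ t, ∃ i < omegaOneMem, τ i = t := by
    obtain ⟨j⟩ : Nonempty (H × OmegaOne × OmegaOne ↪ Set.Iio omegaOneMem) := by
      rw [← Cardinal.lift_mk_le', mk_Iio_omegaTwo]
      have h1 : #(H × OmegaOne × OmegaOne) ≤ ℵ_ 1 := by
        simp only [mk_prod, Cardinal.lift_id, mk_omegaOne]
        calc #H * (ℵ_ 1 * ℵ_ 1) ≤ ℵ_ 1 * (ℵ_ 1 * ℵ_ 1) := by gcongr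
          _ = ℵ_ 1 := by simp
      have h2 : omegaOneMem.1.card = ℵ_ 1 := by simp [omegaOneMem]
      rw [h2]
      simpa using Cardinal.lift_le.{1}.2 h1
    refine ⟨fun i => if h : i < omegaOneMem then Function.invFun j ⟨i, Set.mem_Iio.2 h⟩
      else Classical.arbitrary _, fun t => ⟨j t, Set.mem_Iio.1 (j t).2, ?_⟩⟩
    exact (dif_pos (Set.mem_Iio.1 (j t).2)).trans (Function.leftInverse_invFun j.injective t)
  -- With `τ i = (h, δ, γ)`, `β` is coded by `ε γ (g β δ)` and `ξ < β` by `ε γ (e β ξ)`; `h` guesses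
  -- the second code from the first.
  refine ⟨fun i β => {ξ | ξ < β ∧ e β ξ < (τ i).2.2 ∧
    ε (τ i).2.2 (e β ξ) ∈ (τ i).1.1 (ε (τ i).2.2 (g β (τ i).2.1))}, fun i β => ?_, ?_⟩
  · refine lt_of_le_of_lt (mk_le_one_iff_set_subsingleton.2 ?_) (by norm_num : (1 : Cardinal) < 2)
    rintro ξ ⟨h1, h2, h3⟩ ξ' ⟨h1', h2', h3'⟩
    exact he β h1 h1' (hε _ h2 h2' (subsingleton_of_mk_lt_two (hH.1 _ (τ i).1.2 _) h3 h3'))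
  intro α hα hcof f hf B hB
  have := noMaxOrder_Iio hα
  obtain ⟨b, hb, hbB, hbx⟩ := exists_strictMono_nat_isCofinal_range hcof
    (isCofinal_Iio_inter_Ici hα.1 hB)
  have hfb : ∀ n, f (b n) < b n := fun n => hf _ (zeroMem_lt_iff.1
    (zeroMem_lt_omegaOneMem.trans_le (hbB n).2))
  -- This `δ` makes the `g (b n) δ` distinct; `γ` then bounds everything to be coded.
  obtain ⟨δ, hδ⟩ := exists_forall_lt_of_countable aleph0_lt_cof_omegaOne
    (Set.countable_range fun p : ℕ × ℕ => e (b p.2) (b p.1))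
  obtain ⟨γ, hγ⟩ := exists_forall_lt_of_countable aleph0_lt_cof_omegaOne
    ((Set.countable_range fun n => g (b n) δ).union
      (Set.countable_range fun n => e (b n) (f (b n))))
  have hginj : ∀ m n, m < n → g (b n) δ ≠ g (b m) δ := fun m n hmn =>
    hg _ _ (hb hmn) δ (hδ _ ⟨(m, n), rfl⟩)
  let u : ℕ → ℕ := fun n => ε γ (g (b n) δ)
  have hu : Function.Injective u := by
    intro m n hmn
    have hgmn := hε γ (hγ _ (Or.inl ⟨m, rfl⟩)) (hγ _ (Or.inl ⟨n, rfl⟩)) hmn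
    rcases lt_trichotomy m n with hlt | heq | hlt
    · exact absurd hgmn.symm (hginj m n hlt)
    · exact heq
    · exact absurd hgmn (hginj n m hlt)
  obtain ⟨h, hh, hinf⟩ := hH.exists_infinite (Set.infinite_range_of_injective hu)
    fun m => ε γ (e (b (Function.invFun u m)) (f (b (Function.invFun u m))))
  have hinf' : {n | ε γ (e (b n) (f (b n))) ∈ h (u n)}.Infinite := by
    refine Set.Infinite.of_image u (hinf.mono ?_)
    rintro _ ⟨⟨n, rfl⟩, hn⟩
    rw [Function.leftInverse_invFun hu n] at hn
    exact ⟨n, hn, rfl⟩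
  obtain ⟨i, hi, hτi⟩ := hτ (⟨h, hh⟩, δ, γ)
  refine ⟨i, hi.trans hα.1, ?_, fun a ha => ?_⟩
  · rintro _ ⟨β, -, -, rfl⟩
    exact β.2.le
  · by_contra! hlt
    obtain ⟨N, hN⟩ := hbx ⟨a, hlt⟩
    obtain ⟨n, hn, hNn⟩ := hinf'.exists_gt N
    refine (ha ⟨b n, (hbB n).1, ?_, rfl⟩).not_gt (hN.trans (hb hNn))
    simp only [hτi]
    exact ⟨hfb n, hγ _ (Or.inr ⟨n, rfl⟩), hn⟩

/-! ### The equivalences. -/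

theorem mainTheorem2 :
    List.TFAE
      [idealJ (ω_ 2 : Ordinal.{0}) =
          {S : Set (Set.Iio (ω_ 2 : Ordinal.{0})) | ¬ IsStationary (S ∩ cofSet (ω_ 2) (ℵ_ 1))},
        idealJ (ω_ 2 : Ordinal.{0}) ≠ nonstationaryIdeal (ω_ 2),
        meetingNumber ℕ ℕ ℵ₀ = ℵ_ 1,
        ∃ A : Set ℝ, ¬ IsMeagre A ∧ #A = ℵ_ 1] := by
  have hcof := aleph0_lt_cof_omegaTwo.ne'
  rw [meetingNumber_eq_aleph_one_iff]
  tfae_have 1 → 2 := by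
    intro h1 h2
    have hmem : cofSet (ω_ 2 : Ordinal.{0}) ℵ₀ ∈ idealJ (ω_ 2 : Ordinal.{0}) := by
      rw [h1]
      have : cofSet (ω_ 2 : Ordinal.{0}) ℵ₀ ∩ cofSet (ω_ 2) (ℵ_ 1) = ∅ := by
        ext α
        simp only [cofSet, Set.mem_inter_iff, Set.mem_ofPred_eq, Set.mem_empty_iff_false, iff_false]
        rintro ⟨h, h'⟩
        exact aleph0_lt_aleph_one.ne (h.symm.trans h')
      simp [this]
    rw [h2] at hmem
    exact hmem isStationary_cofSet_aleph0
  tfae_have 2 → 3 := by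
    intro h
    obtain ⟨S, hSJ, hS⟩ : ∃ S ∈ idealJ (ω_ 2 : Ordinal.{0}), IsStationary S := by
      by_contra! hno
      refine h (Set.Subset.antisymm hno fun S hS => ?_)
      obtain ⟨C, hC, hdisj⟩ := not_isStationary_iff.1 hS
      exact ⟨C, hC, fun _ _ => ∅, by simp, fun α hα =>
        (Set.disjoint_left.1 hdisj hα.1 hα.2).elim⟩
    obtain ⟨C, hC, F, hF, hFC⟩ := mem_idealJ_iff.1 hSJ
    -- One point of the stationary set suffices; its cofinality cannot be `ℵ₁`.
    obtain ⟨α, hαS, hαC, hα⟩ := hS (hC.inter hcof isClub_limitSet)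
    have hm := hFC α ⟨hαS, hαC⟩
    rcases cof_Iio_of_mem_limitSet hα with h0 | h1
    · exact exists_isMeetingFamily_of_meetsRegressive hF hα h0 hm
    · exact absurd hm (not_meetsRegressive_of_cof_eq hF hα h1)
  tfae_have 3 → 1 := by
    rintro ⟨H, hH, hc⟩
    refine Set.Subset.antisymm (fun S hS => ?_) fun S hS => ?_
    · obtain ⟨C, hC, F, hF, hFC⟩ := mem_idealJ_iff.1 hS
      refine not_isStationary_iff.2 ⟨_, hC.inter hcof isClub_limitSet, Set.disjoint_left.2 ?_⟩
      rintro α ⟨hαS, hα1⟩ ⟨hαC, hα⟩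
      exact not_meetsRegressive_of_cof_eq hF hα (mem_cofSet_aleph_one_iff.1 hα1)
        (hFC α ⟨hαS, hαC⟩)
    · obtain ⟨C, hC, hdisj⟩ := not_isStationary_iff.1 hS
      obtain ⟨F, hF, hFm⟩ := exists_meetsRegressive_of_isMeetingFamily hH hc
      refine mem_idealJ_iff.2 ⟨_, hC.inter hcof isClub_limitSet, F, hF, ?_⟩
      rintro α ⟨hαS, hαC, hα⟩
      refine hFm α hα ((cof_Iio_of_mem_limitSet hα).resolve_right fun h1 => ?_)
      exact Set.disjoint_left.1 hdisj ⟨hαS, mem_cofSet_aleph_one_iff.2 h1⟩ hαC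
  tfae_have 3 → 4 := fun ⟨_, hH, hc⟩ => exists_not_isMeagre_of_isMeetingFamily hH hc
  tfae_have 4 → 3 := fun ⟨_, hA, hc⟩ => exists_isMeetingFamily_of_not_isMeagre hA hc
  tfae_finish
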